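/- **Setting.** All manifolds and maps are $C^\infty$. Let $X$ be a manifold of dimension $n\ge 1$, let $P\to X$ be a principal bundle with structure group a Lie group $G$, and let $r\le k$. Put $W^{(r,k)}P=J_rP\times_X L_k(X)$, where $L_k(X)$ is the bundle of $k$-frames; its elements are the pairs $(j^x_r\gamma, j^0_k t)$, with $\gamma$ a local section of $P$ and $t:\mathbb R^n\to X$ locally invertible at $0$, $t(0)=x$. It is a principal bundle with group $W^{(r,k)}G=J_rG\odot GL_k(n)$ (jets at $0$ of maps $g:\mathbb R^n\to G$ and of local diffeomorphisms $\alpha$ of $\mathbb R^n$ fixing $0$; action and product by composition of jets). Let $\zeta$ be a smooth left action of $W^{(r,k)}G$ on an $m$-dimensional manifold $F$, and let $\pi: Y_\zeta=W^{(r,k)}P\times_\zeta F\to X$ be the associated gauge-natural bundle. Let $\mathcal A^{(r,k)}$ be the sheaf of right-invariant vector fields on $W^{(r,k)}P$. A field $\bar\Xi\in\mathcal A^{(r,k)}$ over an open set $V\subseteq X$, with local flow $(\Phi_t,\phi_t)$, has as gauge-natural lift the projectable vector field $(\hat\Xi,\xi)$ on $Y_\zeta$ given by $\hat\Xi([w,f])=\frac{d}{dt}\big|_{0}[\Phi_t(w),f]$,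 $\xi(x)=\frac{d}{dt}\big|_0\phi_t(x)$. For a local section $\sigma$ of $Y_\zeta$ put $\pounds_{\bar\Xi}\sigma=T\sigma\circ\xi-\hat\Xi\circ\sigma$, a vertical vector field along $\sigma$; this defines $\pounds_{\bar\Xi}:J_1Y_\zeta\to VY_\zeta$ and its prolongations $j_s\pounds_{\bar\Xi}:J_{s+1}Y_\zeta\to VJ_sY_\zeta$. Let $s\ge 0$, let $D\subseteq Y_\zeta$ be open (for instance $D=Y_\zeta$), and let $\lambda=L\,\omega$ be a Lagrangian of order $s+1$ over $D$, i.e. a smooth fibered morphism $\lambda:J_{s+1}Y_\zeta\to\bigwedge^nT^*X$ over $X$, defined on the jets with value in $D$. (This includes every $\lambda\in\mathcal V^n_s=\Lambda^n_s/\Theta^n_s$, represented by a horizontal $n$-form on $J_{s+1}Y_\zeta$.) In coordinates, with $\omega = dx^1\wedge\dots\wedge dx^n$, $$d_V\lambda=\partial_i^{\boldsymbol\alpha}L\,\vartheta^i_{\boldsymbol\alpha}\wedge\omega,\qquad \mathcal E(\lambda)=\sum_{|\boldsymbol\alpha|\le s+1}(-1)^{|\boldsymbol\alpha|}D_{\boldsymbol\alpha}(\partial_i^{\boldsymbol\alpha}L)\,\vartheta^i\wedge\omega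 .$$ A *momentum* $p_{d_V\lambda}$ associated to $\lambda$ is a smooth fibered morphism $J_{2s+1}Y_\zeta\to V^*J_sY_\zeta\otimes\bigwedge^{n-1}T^*X$ (over $D$), in coordinates $p^{\boldsymbol\alpha\mu}_i\vartheta^i_{\boldsymbol\alpha}\wedge\omega_\mu$ with $|\boldsymbol\alpha|\le s$ and $\omega_\mu=\partial_\mu\rfloor\omega$, such that $d_V\lambda=\mathcal E(\lambda)-d_Hp_{d_V\lambda}$; equivalently, for each local section $\sigma$ and each vertical field $v$ along $\sigma$, with $j$ denoting jet prolongation of sufficiently high order, $(j\sigma)^*(jv\rfloor d_V\lambda)=(j\sigma)^*(v\rfloor\mathcal E(\lambda))+d\big((j\sigma)^*(jv\rfloor p_{d_V\lambda})\big)$. A projectable vector field $(\Xi,\xi)$ on $Y_\zeta$ is a *symmetry* of $\lambda$ if the Lie derivative $\mathcal L_{j_{s+1}\Xi}\lambda$ along its prolongation vanishes. Let $\mathcal K$ be a set of local sections of $\mathcal A^{(r,k)}$ (for instance all of them, or all prolongations to $W^{(r,k)}P$ of right-invariant vector fields of $P$). We say that $\lambda$ is *gauge-natural* (with respect to $\mathcal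 K$) if for every $\bar\Xi\in\mathcal K$ the lift $(\hat\Xi,\xi)$ is a symmetry of $\lambda$; it is then called a gauge-natural symmetry of $\lambda$. **Theorem (Noether's Theorem for gauge-natural Lagrangians).** Let $\lambda$ be a gauge-natural Lagrangian, let $(\hat\Xi,\xi)$ be the gauge-natural symmetry of $\lambda$ that lifts some $\bar\Xi\in\mathcal K$ over $V$, and let $p_{d_V\lambda}$ be any momentum associated to $\lambda$. Put $$\epsilon=-j_s\pounds_{\bar\Xi}\rfloor p_{d_V\lambda}+\xi\rfloor\lambda .$$ 1. On the jets over $V$ with value in $D$ (that is, after pull-back along the prolongation of every local section of $Y_\zeta$ over $V$ with values in $D$) $$0=-\pounds_{\bar\Xi}\rfloor\mathcal E(\lambda)+d_H\epsilon .$$ 2. Let $\sigma$ be a section of $Y_\zeta$ over an open set $U\subseteq V$, with values in $D$, such that $(j\sigma)^*(-\pounds_{\bar\Xi}\rfloor\mathcal E(\lambda))=0$ on $U$. Then the $(n-1)$-form $(j\sigma)^*\epsilon$ satisfies $d\big((j\sigma)^*\epsilon\big)=0$ on $U$. Here $j\sigma$ is the prolongation of $\sigma$ to any jet order on which the form in question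 is defined (order $2s+2$ suffices for $\mathcal E(\lambda)$ and order $2s+1$ for $\epsilon$); the pull-backs do not depend on that order. -/

import Mathlib

open scoped Manifold ContDiff Topology

noncomputable section

namespace GaugeNatural

/-- The model space `ℝᵏ`. -/
abbrev Coord (k : ℕ) : Type := Fin k → ℝ

/-! ### Jets of smooth maps and of local sections -/

section Jets

variable {E H M E' H' N : Type*}
  [NormedAddCommGroup E] [NormedSpace ℝ E] [TopologicalSpace H]
  [TopologicalSpace M] [ChartedSpace H M]
  [NormedAddCommGroup E'] [NormedSpace ℝ E'] [TopologicalSpace H']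
  [TopologicalSpace N] [ChartedSpace H' N]

/-- `f` is of class `C^∞` on a neighbourhood of `x`. -/
def SmoothNear (I : ModelWithCorners ℝ E H) (J : ModelWithCorners ℝ E' H')
    (f : M → N) (x : M) : Prop :=
  ∀ᶠ x' in 𝓝 x, ContMDiffAt I J ∞ f x'

/-- `f` and `g` have the same `r`-jet at `x`: same value and, read in charts, the same derivatives
at `x` up to the order `r`. -/
def SameJet (I : ModelWithCorners ℝ E H) (J : ModelWithCorners ℝ E' H')
    (r : ℕ) (x : M) (f g : M → N) : Prop :=
  f x = g x ∧ ∀ i ≤ r,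
    iteratedFDeriv ℝ i (writtenInExtChartAt I J x f) (extChartAt I x x) =
      iteratedFDeriv ℝ i (writtenInExtChartAt I J x g) (extChartAt I x x)

/-- Equality of `r`-jets, as an equivalence relation on the maps with a given property. -/
def jetSetoid (I : ModelWithCorners ℝ E H) (J : ModelWithCorners ℝ E' H')
    (r : ℕ) (x : M) (S : (M → N) → Prop) : Setoid {f : M → N // S f} where
  r f g := SameJet I J r x f.1 g.1
  iseqv :=
    { refl := fun _ => ⟨rfl, fun _ _ => rfl⟩
      symm := fun h => ⟨h.1.symm, fun i hi => (h.2 i hi).symm⟩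
      trans := fun h h' => ⟨h.1.trans h'.1, fun i hi => (h.2 i hi).trans (h'.2 i hi)⟩ }

/-- `σ` is a smooth section of `π : N → M` on a neighbourhood of `x`. -/
def IsSectionAt (I : ModelWithCorners ℝ E H) (J : ModelWithCorners ℝ E' H')
    (π : N → M) (x : M) (σ : M → N) : Prop :=
  SmoothNear I J σ x ∧ ∀ᶠ x' in 𝓝 x, π (σ x') = x'

/-- The fibre over `x` of the `r`-th jet space `J_r N` of `π : N → M`: the `r`-jets at `x` of local
smooth sections of `π`. -/
def Jet (I : ModelWithCorners ℝ E H) (J : ModelWithCorners ℝ E' H')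
    (π : N → M) (r : ℕ) (x : M) : Type _ :=
  Quotient (jetSetoid I J r x (IsSectionAt I J π x))

/-- The jet `j_r σ` at `x`. -/
def Jet.mk {I : ModelWithCorners ℝ E H} {J : ModelWithCorners ℝ E' H'}
    {π : N → M} (r : ℕ) {x : M} (σ : M → N) (h : IsSectionAt I J π x σ) : Jet I J π r x :=
  Quotient.mk (jetSetoid I J r x (IsSectionAt I J π x)) ⟨σ, h⟩

end Jets

/-! ### Coordinates on jet spaces -/

/-- Multi-indices `α = (α₁, …, α_N)` with `|α| ≤ q`. -/
abbrev MultiIdx (N q : ℕ) : Type := {α : Fin N → ℕ // ∑ i, α i ≤ q}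

instance (N q : ℕ) : Finite (MultiIdx N q) :=
  Set.Finite.subset (Set.finite_Iic (fun _ : Fin N => q)) fun α (hα : ∑ i, α i ≤ q) i =>
    (Finset.single_le_sum (fun _ _ => Nat.zero_le _) (Finset.mem_univ i)).trans hα

instance (N q : ℕ) : Fintype (MultiIdx N q) := Fintype.ofFinite _

/-- The multi-index `0`. -/
def zeroIdx (N q : ℕ) : MultiIdx N q := ⟨fun _ => 0, by simp⟩

/-- The coordinate space `(x^μ, y^i_α)`, `|α| ≤ q`, of the `q`-th jet space. -/
abbrev JetCoord (N m q : ℕ) : Type := Coord N × (MultiIdx N q → Coord m)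

/-- The mixed partial derivative `∂_α f = ∂₁^{α₁} ⋯ ∂_N^{α_N} f`. -/
def mixedPartial {N : ℕ} {V : Type*} [NormedAddCommGroup V] [NormedSpace ℝ V]
    (α : Fin N → ℕ) (f : Coord N → V) : Coord N → V :=
  (List.finRange N).foldr
    (fun i g => (fun (h : Coord N → V) u => fderiv ℝ h u (Pi.single i 1))^[α i] g) f

/-! ### Fibered manifolds, forms -/

section Fibered

variable {N m : ℕ} {X Y : Type*}
  [TopologicalSpace X] [ChartedSpace (Coord N) X]
  [TopologicalSpace Y] [ChartedSpace (Coord N × Coord m) Y]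

/-- The model of the base. -/
abbrev IX (N : ℕ) : ModelWithCorners ℝ (Coord N) (Coord N) := 𝓘(ℝ, Coord N)

/-- The model of the total space, of dimension `N + m`. -/
abbrev IY (N m : ℕ) : ModelWithCorners ℝ (Coord N × Coord m) (Coord N × Coord m) :=
  𝓘(ℝ, Coord N × Coord m)

/-- A chart `(x^μ, y^i)` of `Y` adapted to `π : Y → X`, over a chart `x^μ` of `X`. -/
structure AdaptedChart (π : Y → X) where
  base : OpenPartialHomeomorph X (Coord N)
  total : OpenPartialHomeomorph Y (Coord N × Coord m)
  base_mem : base ∈ IsManifold.maximalAtlas (IX N) ∞ X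
  total_mem : total ∈ IsManifold.maximalAtlas (IY N m) ∞ Y
  mapsTo : ∀ y ∈ total.source, π y ∈ base.source
  adapted : ∀ y ∈ total.source, (total y).1 = base (π y)

/-- `π : Y → X` is a fibered manifold: a smooth submersion, i.e. every point of `Y` has an adapted
chart (over the given chart of `X`). -/
structure IsFibered (π : Y → X) : Prop where
  smooth : ContMDiff (IY N m) (IX N) ∞ π
  exists_chart : ∀ y, ∃ κ : AdaptedChart (N := N) (m := m) π,
    y ∈ κ.total.source ∧ κ.base = chartAt (Coord N) (π y)

/-- A chosen adapted chart at `y`. -/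
def IsFibered.chart {π : Y → X} (h : IsFibered (N := N) (m := m) π) (y : Y) :
    AdaptedChart (N := N) (m := m) π :=
  (h.exists_chart y).choose

variable (N) in
/-- `Λ^p T_x^* X`. -/
abbrev Alt (p : ℕ) (x : X) : Type :=
  (TangentSpace (IX N) x) [⋀^Fin p]→L[ℝ] ℝ

/-- The interior product `v ⌋ b = b(v, ·, …, ·)`. -/
def interiorProd {p : ℕ} {x : X} (v : TangentSpace (IX N) x) (b : Alt N (p + 1) x) : Alt N p x :=
  ContinuousAlternatingMap.curryLeft (E := Coord N) b v

/-- The alternating form at `x` with coordinate expression `b` in the chart `c` of `X`. -/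
def ofCoord {p : ℕ} (c : OpenPartialHomeomorph X (Coord N)) (x : X)
    (b : Coord N [⋀^Fin p]→L[ℝ] ℝ) : Alt N p x :=
  b.compContinuousLinearMap (mfderiv (IX N) 𝓘(ℝ, Coord N) c x)

/-- The exterior derivative at `x` of a differential form on `X`, computed in the chart at `x`. -/
def extD {p : ℕ} (β : ∀ x : X, Alt N p x) (x : X) : Alt N (p + 1) x :=
  ofCoord (chartAt (Coord N) x) x
    (extDeriv (fun u : Coord N =>
        (β ((chartAt (Coord N) x).symm u)).compContinuousLinearMap
          (mfderiv 𝓘(ℝ, Coord N) (IX N) (chartAt (Coord N) x).symm u))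
      (chartAt (Coord N) x x))

namespace AdaptedChart

variable {π : Y → X} (κ : AdaptedChart (N := N) (m := m) π)

/-- The coordinate expression `u ↦ (σ^i(u))` of a section. -/
def sec (σ : X → Y) (u : Coord N) : Coord m := (κ.total (σ (κ.base.symm u))).2

/-- The coordinates `(x^μ, ∂_α σ^i(x))` of `j_q σ` at the point of `X` with coordinates `u`. -/
def jet (q : ℕ) (σ : X → Y) (u : Coord N) : JetCoord N m q :=
  (u, fun α => mixedPartial α.1 (κ.sec σ) u)

/-- The points of the coordinate space of `J_q Y` that lie over `D ⊆ Y`. -/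
def jetDomain (D : Set Y) (q : ℕ) : Set (JetCoord N m q) :=
  {z | (z.1, z.2 (zeroIdx N q)) ∈ κ.total.target ∧
    κ.total.symm (z.1, z.2 (zeroIdx N q)) ∈ D}

/-- The fibre components `v^i` of a tangent vector of `Y`. -/
def vert (v : TangentBundle (IY N m) Y) : Coord m :=
  (show Coord N × Coord m from mfderiv (IY N m) 𝓘(ℝ, Coord N × Coord m) κ.total v.proj v.2).2

/-- The coordinate expression `u ↦ (v^i(u))` of a section of `VY → X`. -/
def vertSec (v : X → TangentBundle (IY N m) Y) (u : Coord N) : Coord m := κ.vert (v (κ.base.symm u))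

end AdaptedChart

/-- A horizontal `p`-form of order `q` over the open set `D ⊆ Y`: a smooth fibered morphism
`J_q Y → Λ^p T^*X` over `X`, defined on the jets with value in `D` (and arbitrary elsewhere).
A Lagrangian of order `q` is the case `p = dim X`. -/
structure HorizontalForm (π : Y → X) (D : Set Y) (q p : ℕ) where
  toFun : ∀ x : X, Jet (IX N) (IY N m) π q x → Alt N p x
  smooth : ∀ κ : AdaptedChart (N := N) (m := m) π,
    ∃ b : JetCoord N m q → (Coord N [⋀^Fin p]→L[ℝ] ℝ),
      ContDiffOn ℝ ∞ b (κ.jetDomain D q) ∧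
      ∀ (x : X) (σ : X → Y) (h : IsSectionAt (IX N) (IY N m) π x σ),
        σ x ∈ κ.total.source → σ x ∈ D →
        toFun x (Jet.mk q σ h) = ofCoord κ.base x (b (κ.jet q σ (κ.base x)))

/-- The coordinate expression `(x^μ, y^i_α) ↦ b(x^μ, y^i_α)` of a horizontal form; on the domain of
the chart it is unique, and for a Lagrangian it is `L dx¹ ∧ ⋯ ∧ dx^N`. -/
def HorizontalForm.coord {π : Y → X} {D : Set Y} {q p : ℕ}
    (β : HorizontalForm (N := N) (m := m) π D q p) (κ : AdaptedChart (N := N) (m := m) π) :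
    JetCoord N m q → (Coord N [⋀^Fin p]→L[ℝ] ℝ) :=
  (β.smooth κ).choose

open Classical in
/-- The pull-back `(j_q σ)^* β`, a `p`-form on the domain of the section `σ`. -/
def HorizontalForm.pullback {π : Y → X} {D : Set Y} {q p : ℕ}
    (β : HorizontalForm (N := N) (m := m) π D q p) (σ : X → Y) (x : X) : Alt N p x :=
  if h : IsSectionAt (IX N) (IY N m) π x σ then β.toFun x (Jet.mk q σ h) else 0

/-! ### Variational calculus -/

variable [IsManifold (IX N) ∞ X] [IsManifold (IY N m) ∞ Y]

/-- The projection `TY → X`. -/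
def tangentProj (N m : ℕ) {X Y : Type*} [TopologicalSpace Y] [ChartedSpace (Coord N × Coord m) Y]
    (π : Y → X) (v : TangentBundle (IY N m) Y) : X := π v.proj

/-- `v` is, near `x`, a smooth section of `VY → X` along the section `σ`: its value at `x'` is a
tangent vector of `Y` at `σ x'` which is vertical with respect to `π`. -/
def IsVerticalAlong (π : Y → X) (x : X) (σ : X → Y) (v : X → TangentBundle (IY N m) Y) : Prop :=
  IsSectionAt (IX N) (IY N m).tangent (tangentProj N m π) x v ∧
    ∀ᶠ x' in 𝓝 x, (v x').proj = σ x' ∧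
      mfderiv (IY N m) (IX N) π (v x').proj (v x').2 = 0

/-- `(j_q σ)^*(j_q v ⌋ d_V λ)` at `x`, for a vertical field `v` along `σ`, where
`d_V λ = ∂_i^α L ϑ^i_α ∧ ω`: in coordinates it is `∂_i^α L(j_q σ) ∂_α v^i ω`. -/
def dVert {π : Y → X} (hπ : IsFibered (N := N) (m := m) π) {D : Set Y} {q : ℕ}
    (L : HorizontalForm (N := N) (m := m) π D q N)
    (σ : X → Y) (v : X → TangentBundle (IY N m) Y) (x : X) : Alt N N x :=
  let κ := hπ.chart (σ x)
  let u := κ.base x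
  ofCoord κ.base x
    (fderiv ℝ (L.coord κ) (κ.jet q σ u) (0, fun α => mixedPartial α.1 (κ.vertSec v) u))

/-- The Euler–Lagrange morphism along `σ`, contracted with a vertical vector `v` at `σ x`, that is
`(j_{2q} σ)^*(v ⌋ E(λ))` at `x`: in coordinates
`v^i ∑_{|α| ≤ q} (-1)^|α| D_α (∂_i^α L) ω`, where `(D_α f) ∘ jσ = ∂_α (f ∘ jσ)`.
It does not depend on the chart. -/
def eulerLagrange {π : Y → X} (hπ : IsFibered (N := N) (m := m) π) {D : Set Y} {q : ℕ}
    (L : HorizontalForm (N := N) (m := m) π D q N)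
    (σ : X → Y) (v : TangentBundle (IY N m) Y) (x : X) : Alt N N x :=
  let κ := hπ.chart (σ x)
  ofCoord κ.base x
    (∑ α : MultiIdx N q, (-1 : ℝ) ^ (∑ i, α.1 i) •
      mixedPartial α.1
        (fun u => fderiv ℝ (L.coord κ) (κ.jet q σ u) (0, Pi.single α (κ.vert v))) (κ.base x))

/-- A smooth fibered morphism `p : J_a Y → V^*(J_b Y) ⊗ Λ^k T^*X`, i.e. an element of
`C_b ∧ H^k`, over the open set `D ⊆ Y`. By the isomorphism `V J_b Y ≅ J_b VY` it is given on pairs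
of an `a`-jet of a section `σ` and a `b`-jet of a vertical field `v` along `σ` (and arbitrary on
other pairs); in coordinates it is `p^α_i(x, y) ∂_α v^i`, `|α| ≤ b`. -/
structure ContactForm (π : Y → X) (D : Set Y) (a b k : ℕ) where
  toFun : ∀ x : X, Jet (IX N) (IY N m) π a x →
    Jet (IX N) (IY N m).tangent (tangentProj N m π) b x → Alt N k x
  smooth : ∀ κ : AdaptedChart (N := N) (m := m) π,
    ∃ P : JetCoord N m a → ((MultiIdx N b → Coord m) →L[ℝ] (Coord N [⋀^Fin k]→L[ℝ] ℝ)),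
      ContDiffOn ℝ ∞ P (κ.jetDomain D a) ∧
      ∀ (x : X) (σ : X → Y) (v : X → TangentBundle (IY N m) Y)
        (h : IsSectionAt (IX N) (IY N m) π x σ) (h' : IsVerticalAlong π x σ v),
        σ x ∈ κ.total.source → σ x ∈ D →
        toFun x (Jet.mk a σ h) (Jet.mk b v h'.1) = ofCoord κ.base x
          (P (κ.jet a σ (κ.base x)) fun α => mixedPartial α.1 (κ.vertSec v) (κ.base x))

open Classical in
/-- The contraction `(j_a σ)^*(j_b v ⌋ p)` for a vertical field `v` along `σ`, a `k`-form on the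
domain of `σ`. -/
def ContactForm.contract {π : Y → X} {D : Set Y} {a b k : ℕ}
    (p : ContactForm (N := N) (m := m) π D a b k)
    (σ : X → Y) (v : X → TangentBundle (IY N m) Y) (x : X) : Alt N k x :=
  if h : IsSectionAt (IX N) (IY N m) π x σ ∧ IsVerticalAlong π x σ v then
    p.toFun x (Jet.mk a σ h.1) (Jet.mk b v h.2.1)
  else 0

/-- A projectable vector field `(Ξ, ξ)` over the open set `V ⊆ X`. -/
structure ProjectableField (π : Y → X) (V : Set X) where
  total : ∀ y : Y, TangentSpace (IY N m) y
  base : ∀ x : X, TangentSpace (IX N) x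
  smooth_total : ContMDiffOn (IY N m) (IY N m).tangent ∞
    (fun y => (⟨y, total y⟩ : TangentBundle (IY N m) Y)) (π ⁻¹' V)
  smooth_base : ContMDiffOn (IX N) (IX N).tangent ∞
    (fun x => (⟨x, base x⟩ : TangentBundle (IX N) X)) V
  proj : ∀ y ∈ π ⁻¹' V, mfderiv (IY N m) (IX N) π y (total y) = base (π y)

namespace ProjectableField

variable {π : Y → X} {V : Set X} (Ξ : ProjectableField (N := N) (m := m) π V)

/-- The generalized Lie derivative `£_Ξ σ = Tσ ∘ ξ - Ξ ∘ σ : X → VY`. -/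
def lieSec (σ : X → Y) (x : X) : TangentBundle (IY N m) Y :=
  ⟨σ x, mfderiv (IX N) (IY N m) σ x (Ξ.base x) - Ξ.total (σ x)⟩

/-- The coordinate expression `ξ^μ` of the field on the base. -/
def baseCoord (κ : AdaptedChart (N := N) (m := m) π) (u : Coord N) : Coord N :=
  mfderiv (IX N) 𝓘(ℝ, Coord N) κ.base (κ.base.symm u) (Ξ.base (κ.base.symm u))

/-- The components `(Ξ_V)^i = Ξ^i - y^i_μ ξ^μ` of the vertical part, along `σ`. -/
def vertPart (κ : AdaptedChart (N := N) (m := m) π) (σ : X → Y) (u : Coord N) : Coord m :=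
  κ.vert ⟨σ (κ.base.symm u), Ξ.total (σ (κ.base.symm u))⟩ -
    fderiv ℝ (κ.sec σ) u (Ξ.baseCoord κ u)

/-- The prolongation `j_q Ξ = (j_q Ξ)_H + (j_q Ξ)_V` at the point `j_q σ`, in coordinates:
`ξ^μ ∂_μ + (D_α (Ξ_V)^i + ξ^μ y^i_{α+μ}) ∂_i^α`. -/
def prolong (κ : AdaptedChart (N := N) (m := m) π) (q : ℕ) (σ : X → Y) (u : Coord N) :
    JetCoord N m q :=
  (Ξ.baseCoord κ u, fun α =>
    mixedPartial α.1 (Ξ.vertPart κ σ) u +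
      fderiv ℝ (mixedPartial α.1 (κ.sec σ)) u (Ξ.baseCoord κ u))

end ProjectableField

/-- The Lie derivative of a Lagrangian `λ = L dx¹ ∧ ⋯ ∧ dx^N` on `J_q Y` along the prolongation
`j_q Ξ`, at the point `j_q σ` over `x`: `((j_q Ξ) L + L ∂_μ ξ^μ) dx¹ ∧ ⋯ ∧ dx^N`. -/
def lieDeriv {π : Y → X} (hπ : IsFibered (N := N) (m := m) π) {D : Set Y} {q : ℕ} {V : Set X}
    (Ξ : ProjectableField (N := N) (m := m) π V) (L : HorizontalForm (N := N) (m := m) π D q N)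
    (σ : X → Y) (x : X) : Alt N N x :=
  let κ := hπ.chart (σ x)
  let u := κ.base x
  ofCoord κ.base x
    (fderiv ℝ (L.coord κ) (κ.jet q σ u) (Ξ.prolong κ q σ u) +
      (∑ i : Fin N, fderiv ℝ (Ξ.baseCoord κ) u (Pi.single i 1) i) • L.coord κ (κ.jet q σ u))

/-- `Ξ` is a symmetry of the Lagrangian `λ`: the Lie derivative of `λ` along the prolongation of
`Ξ` vanishes (at every jet over `V` with value in `D`). -/
def IsSymmetry {π : Y → X} (hπ : IsFibered (N := N) (m := m) π) {D : Set Y} {q : ℕ} {V : Set X}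
    (L : HorizontalForm (N := N) (m := m) π D q N)
    (Ξ : ProjectableField (N := N) (m := m) π V) : Prop :=
  ∀ x ∈ V, ∀ σ : X → Y, IsSectionAt (IX N) (IY N m) π x σ → σ x ∈ D →
    lieDeriv hπ Ξ L σ x = 0

end Fibered

section Variation

variable {n m : ℕ} {X Y : Type*}
  [TopologicalSpace X] [ChartedSpace (Coord (n + 1)) X] [IsManifold (IX (n + 1)) ∞ X]
  [TopologicalSpace Y] [ChartedSpace (Coord (n + 1) × Coord m) Y] [IsManifold (IY (n + 1) m) ∞ Y]

/-- `p` is a momentum `p_{d_V λ}` associated to the Lagrangian `λ`: it realizes the integration by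
parts `d_V λ = E(λ) - d_H p`, i.e. for every local section `σ` and every vertical field `v` along
`σ` one has `jσ^*(jv ⌋ d_V λ) = jσ^*(v ⌋ E(λ)) + d (jσ^*(jv ⌋ p))`. -/
def IsMomentum {π : Y → X} (hπ : IsFibered (N := n + 1) (m := m) π) {D : Set Y} {q a b : ℕ}
    (L : HorizontalForm (N := n + 1) (m := m) π D q (n + 1))
    (p : ContactForm (N := n + 1) (m := m) π D a b n) : Prop :=
  ∀ (x : X) (σ : X → Y) (v : X → TangentBundle (IY (n + 1) m) Y),
    IsSectionAt (IX (n + 1)) (IY (n + 1) m) π x σ → IsVerticalAlong π x σ v → σ x ∈ D →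
    dVert hπ L σ v x = eulerLagrange hπ L σ (v x) x + extD (p.contract σ v) x

/-- The current `ε = - j_b £_Ξ ⌋ p + ξ ⌋ λ` pulled back along `σ`: the form `(jσ)^* ε` on the
domain of the section `σ`. -/
def currentAlong {π : Y → X} {D : Set Y} {q a b : ℕ} {V : Set X}
    (L : HorizontalForm (N := n + 1) (m := m) π D q (n + 1))
    (p : ContactForm (N := n + 1) (m := m) π D a b n)
    (Ξ : ProjectableField (N := n + 1) (m := m) π V) (σ : X → Y) (x : X) : Alt (n + 1) n x :=
  -p.contract σ (Ξ.lieSec σ) x + interiorProd (Ξ.base x) (L.pullback σ x)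

end Variation

/-! ### Principal bundles and gauge-natural prolongations -/

section GaugeNaturalBundles

variable {N : ℕ} {EG EP G X P : Type*}
  [NormedAddCommGroup EG] [NormedSpace ℝ EG] [NormedAddCommGroup EP] [NormedSpace ℝ EP]
  [TopologicalSpace G] [ChartedSpace EG G] [Group G]
  [TopologicalSpace X] [ChartedSpace (Coord N) X]
  [TopologicalSpace P] [ChartedSpace EP P] [MulAction Gᵐᵒᵖ P]

/-- `πP : P → X` is a smooth principal bundle with structure group `G`, which acts on `P` from the
right, `p · g = MulOpposite.op g • p`. -/
structure IsPrincipalBundle (N : ℕ) (EG EP G : Type*) {X P : Type*}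
    [NormedAddCommGroup EG] [NormedSpace ℝ EG] [NormedAddCommGroup EP] [NormedSpace ℝ EP]
    [TopologicalSpace G] [ChartedSpace EG G] [Group G]
    [TopologicalSpace X] [ChartedSpace (Coord N) X]
    [TopologicalSpace P] [ChartedSpace EP P] [MulAction Gᵐᵒᵖ P] (πP : P → X) : Prop where
  smooth_proj : ContMDiff 𝓘(ℝ, EP) (IX N) ∞ πP
  smooth_act : ContMDiff (𝓘(ℝ, EP).prod 𝓘(ℝ, EG)) 𝓘(ℝ, EP) ∞
    (fun z : P × G => MulOpposite.op z.2 • z.1)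
  proj_act : ∀ (p : P) (g : G), πP (MulOpposite.op g • p) = πP p
  free : ∀ (p : P) (g : G), MulOpposite.op g • p = p → g = 1
  locally_trivial : ∀ x : X, ∃ U : Set X, IsOpen U ∧ x ∈ U ∧ ∃ (s : X → P) (τ : P → G),
    ContMDiffOn (IX N) 𝓘(ℝ, EP) ∞ s U ∧ (∀ x' ∈ U, πP (s x') = x') ∧
    ContMDiffOn 𝓘(ℝ, EP) 𝓘(ℝ, EG) ∞ τ (πP ⁻¹' U) ∧
    ∀ p ∈ πP ⁻¹' U, MulOpposite.op (τ p) • s (πP p) = p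

variable (N) in
/-- `t : ℝᴺ → X` is smooth near `0`, locally invertible at `0`, and `t(0) = x`. -/
def IsFrameMap (x : X) (t : Coord N → X) : Prop :=
  SmoothNear (IX N) (IX N) t 0 ∧ t 0 = x ∧ Function.Bijective (mfderiv (IX N) (IX N) t 0)

variable (N) in
/-- The fibre at `x` of the bundle `L_k(X)` of `k`-frames: the jets `j^0_k t`. -/
def Frame (k : ℕ) (x : X) : Type _ :=
  Quotient (jetSetoid (IX N) (IX N) k (0 : Coord N) (IsFrameMap N x))

/-- The group `J_r G` of `r`-jets at `0` of smooth maps `ℝᴺ → G`. -/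
def GroupJet (N : ℕ) (EG G : Type*) [NormedAddCommGroup EG] [NormedSpace ℝ EG]
    [TopologicalSpace G] [ChartedSpace EG G] (r : ℕ) : Type _ :=
  Quotient (jetSetoid (IX N) 𝓘(ℝ, EG) r (0 : Coord N)
    (fun g : Coord N → G => SmoothNear (IX N) 𝓘(ℝ, EG) g 0))

/-- The gauge-natural prolongation `W^{(r,k)} G = J_r G ⊙ GL_k(N)` (as a set); `GL_k(N)` is the
set of `k`-frames of `ℝᴺ` at `0`. -/
abbrev WG (N : ℕ) (EG G : Type*) [NormedAddCommGroup EG] [NormedSpace ℝ EG]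
    [TopologicalSpace G] [ChartedSpace EG G] (r k : ℕ) : Type _ :=
  GroupJet N EG G r × Frame N k (0 : Coord N)

/-- The gauge-natural prolongation `W^{(r,k)} P = J_r P ×_X L_k(X)` (as a set over `X`). -/
abbrev WP (N : ℕ) (EP : Type*) {X P : Type*} [NormedAddCommGroup EP] [NormedSpace ℝ EP]
    [TopologicalSpace X] [ChartedSpace (Coord N) X]
    [TopologicalSpace P] [ChartedSpace EP P] (πP : P → X) (r k : ℕ) : Type _ :=
  Σ x : X, Jet (IX N) 𝓘(ℝ, EP) πP r x × Frame N k x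

variable {πP : P → X} {r k : ℕ}

/-- `w = (j^x_r γ, j^0_k t)`. -/
def WP.IsRep (w : WP N EP πP r k) (γ : X → P) (t : Coord N → X) : Prop :=
  ∃ (hγ : IsSectionAt (IX N) 𝓘(ℝ, EP) πP w.1 γ) (ht : IsFrameMap N w.1 t),
    w.2 = (Jet.mk r γ hγ, Quotient.mk _ ⟨t, ht⟩)

/-- `a = (j^0_r g, j^0_k α)`. -/
def WG.IsRep (a : WG N EG G r k) (g : Coord N → G) (α : Coord N → Coord N) : Prop :=
  ∃ (hg : SmoothNear (IX N) 𝓘(ℝ, EG) g 0) (hα : IsFrameMap N (0 : Coord N) α),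
    a = (Quotient.mk _ ⟨g, hg⟩, Quotient.mk _ ⟨α, hα⟩)

/-- `c = a b` in the semidirect product `W^{(r,k)} G`: composition of jets,
`(g, α)(h, β) = ((g ∘ β) h, α ∘ β)`. -/
def WG.IsMul (a b c : WG N EG G r k) : Prop :=
  ∃ (g h : Coord N → G) (α β : Coord N → Coord N),
    WG.IsRep a g α ∧ WG.IsRep b h β ∧ WG.IsRep c (fun u => g (β u) * h u) (α ∘ β)

/-- `w' = w · a` for the right action of `W^{(r,k)} G` on `W^{(r,k)} P` by composition of jets:
`(γ, t) · (g, α) = (γ', t ∘ α)` with `γ' ∘ t ∘ α = (γ ∘ t ∘ α) · g`. -/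
def WP.IsRightMul (w : WP N EP πP r k) (a : WG N EG G r k) (w' : WP N EP πP r k) : Prop :=
  ∃ (γ γ' : X → P) (t : Coord N → X) (g : Coord N → G) (α : Coord N → Coord N),
    WP.IsRep w γ t ∧ WG.IsRep a g α ∧ WP.IsRep w' γ' (t ∘ α) ∧
    ∀ᶠ u in 𝓝 (0 : Coord N), γ' (t (α u)) = MulOpposite.op (g u) • γ (t (α u))

/-- A map from `ℝᵈ` into the manifold `W^{(r,k)} P` is smooth near `u₀`: it is the family of jets of
a smooth family of sections of `P` and of frame maps. -/
def WP.SmoothFamily {d : ℕ} (c : Coord d → WP N EP πP r k) (u₀ : Coord d) : Prop :=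
  ∃ (Γ : Coord d → X → P) (T : Coord d → Coord N → X),
    SmoothNear (𝓘(ℝ, Coord d).prod (IX N)) 𝓘(ℝ, EP) (Function.uncurry Γ) (u₀, T u₀ 0) ∧
    SmoothNear (𝓘(ℝ, Coord d).prod (IX N)) (IX N) (Function.uncurry T) (u₀, 0) ∧
    ∀ᶠ u in 𝓝 u₀, WP.IsRep (c u) (Γ u) (T u)

/-- `ζ` is a smooth left action of the Lie group `W^{(r,k)} G` on the manifold `F`. Smoothness means
that `ζ` is smooth along smooth families of jets and of points of `F`. -/
structure IsLeftAction {m : ℕ} {F : Type*} [TopologicalSpace F] [ChartedSpace (Coord m) F]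
    (ζ : WG N EG G r k → F → F) : Prop where
  one : ∀ (e : WG N EG G r k) (f : F), WG.IsRep e (fun _ => 1) id → ζ e f = f
  mul : ∀ (a b c : WG N EG G r k) (f : F), WG.IsMul a b c → ζ c f = ζ a (ζ b f)
  smooth : ∀ (d : ℕ) (g : Coord d → Coord N → G) (α : Coord d → Coord N → Coord N)
    (a : Coord d → WG N EG G r k) (f : Coord d → F) (u₀ : Coord d),
    SmoothNear (𝓘(ℝ, Coord d).prod (IX N)) 𝓘(ℝ, EG) (Function.uncurry g) (u₀, 0) →
    SmoothNear (𝓘(ℝ, Coord d).prod (IX N)) (IX N) (Function.uncurry α) (u₀, 0) →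
    SmoothNear 𝓘(ℝ, Coord d) 𝓘(ℝ, Coord m) f u₀ →
    (∀ᶠ u in 𝓝 u₀, WG.IsRep (a u) (g u) (α u)) →
    SmoothNear 𝓘(ℝ, Coord d) 𝓘(ℝ, Coord m) (fun u => ζ (a u) (f u)) u₀

/-- `π : Y → X` is the gauge-natural bundle `Y_ζ = W^{(r,k)} P ×_ζ F` with class map
`cls w f = [w, f]_ζ`. The points are the classes for `(w · a, f) ∼ (w, ζ_a f)`, and the smooth
structure of `Y` is the quotient one: the smooth maps `ℝᵈ → Y` are exactly those which locally are
of the form `[w(u), f(u)]` with smooth `w(u)` and `f(u)`. -/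
structure IsAssociatedBundle {m : ℕ} {F Y : Type*}
    [TopologicalSpace F] [ChartedSpace (Coord m) F]
    [TopologicalSpace Y] [ChartedSpace (Coord N × Coord m) Y]
    (ζ : WG N EG G r k → F → F) (cls : WP N EP πP r k → F → Y) (π : Y → X) : Prop where
  surjective : ∀ y : Y, ∃ w f, cls w f = y
  eq_iff : ∀ w f w' f', cls w f = cls w' f' ↔ ∃ a : WG N EG G r k, WP.IsRightMul w a w' ∧ f = ζ a f'
  proj : ∀ w f, π (cls w f) = w.1
  smooth_iff : ∀ (d : ℕ) (c : Coord d → Y) (u₀ : Coord d),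
    SmoothNear 𝓘(ℝ, Coord d) (IY N m) c u₀ ↔
      ∃ (w : Coord d → WP N EP πP r k) (f : Coord d → F),
        WP.SmoothFamily w u₀ ∧ SmoothNear 𝓘(ℝ, Coord d) 𝓘(ℝ, Coord m) f u₀ ∧
        ∀ᶠ u in 𝓝 u₀, c u = cls (w u) (f u)
  fibered : IsFibered (N := N) (m := m) π

/-- A (local) right-invariant vector field `Ξ̄` on `W^{(r,k)} P`, i.e. a local section of
`A^{(r,k)}`, given by its local flow `(Φ_t, φ_t)` of principal automorphisms of `W^{(r,k)} P`;
`dom` is the open domain of `(t, x) ↦ φ_t(x)`. -/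
structure InfAut (N : ℕ) (EG EP G : Type*) {X P : Type*}
    [NormedAddCommGroup EG] [NormedSpace ℝ EG] [NormedAddCommGroup EP] [NormedSpace ℝ EP]
    [TopologicalSpace G] [ChartedSpace EG G] [Group G]
    [TopologicalSpace X] [ChartedSpace (Coord N) X]
    [TopologicalSpace P] [ChartedSpace EP P] [MulAction Gᵐᵒᵖ P]
    (πP : P → X) (r k : ℕ) where
  dom : Set (ℝ × X)
  isOpen_dom : IsOpen dom
  flow : ℝ → WP N EP πP r k → WP N EP πP r k
  baseFlow : ℝ → X → X
  proj : ∀ t w, (t, w.1) ∈ dom → (flow t w).1 = baseFlow t w.1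
  zero : ∀ w, (0, w.1) ∈ dom → flow 0 w = w
  zero_mem : ∀ t x, (t, x) ∈ dom → (0, x) ∈ dom
  add : ∀ s t w, (s, w.1) ∈ dom → (t, baseFlow s w.1) ∈ dom → (t + s, w.1) ∈ dom →
    flow (t + s) w = flow t (flow s w)
  equivariant : ∀ t w w' (a : WG N EG G r k), (t, w.1) ∈ dom →
    WP.IsRightMul w a w' → WP.IsRightMul (flow t w) a (flow t w')
  smooth : ∀ (d : ℕ) (τ : Coord d → ℝ) (c : Coord d → WP N EP πP r k) (u₀ : Coord d),
    SmoothNear 𝓘(ℝ, Coord d) 𝓘(ℝ, ℝ) τ u₀ → WP.SmoothFamily c u₀ →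
    (τ u₀, (c u₀).1) ∈ dom → WP.SmoothFamily (fun u => flow (τ u) (c u)) u₀

/-- The open subset of `X` over which the field is defined. -/
def InfAut.carrier (Φ : InfAut N EG EP G πP r k) : Set X :=
  {x | (0, x) ∈ Φ.dom}

/-- The projectable field `(Ξ̂, ξ)` on `Y_ζ` is the gauge-natural lift of the right-invariant field
`Ξ̄` with flow `(Φ_t, φ_t)`: `Ξ̂([w, f]) = d/dt [Φ_t(w), f]` and `ξ(x) = d/dt φ_t(x)` at `t = 0`. -/
def IsGaugeNaturalLift {m : ℕ} {F Y : Type*}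
    [TopologicalSpace Y] [ChartedSpace (Coord N × Coord m) Y]
    [IsManifold (IX N) ∞ X] [IsManifold (IY N m) ∞ Y] {π : Y → X} (cls : WP N EP πP r k → F → Y) (Φ : InfAut N EG EP G πP r k)
    (Ξ : ProjectableField (N := N) (m := m) π Φ.carrier) : Prop :=
  (∀ w f, w.1 ∈ Φ.carrier → HasMFDerivAt 𝓘(ℝ, ℝ) (IY N m) (fun t : ℝ => cls (Φ.flow t w) f) 0
    (ContinuousLinearMap.toSpanSingleton ℝ
      (show Coord N × Coord m from Ξ.total (cls w f)))) ∧
  ∀ x ∈ Φ.carrier, HasMFDerivAt 𝓘(ℝ, ℝ) (IX N) (fun t : ℝ => Φ.baseFlow t x) 0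
    (ContinuousLinearMap.toSpanSingleton ℝ (show Coord N from Ξ.base x))

/-- The Lagrangian `λ` is gauge-natural with respect to a class `K` of right-invariant fields on
`W^{(r,k)} P`: the gauge-natural lift of every member of `K` is a symmetry of `λ`. The class may be
that of all (local) sections of `A^{(r,k)}`, or that of all prolongations of right-invariant fields
of `P`. -/
def IsGaugeNatural {m : ℕ} {F Y : Type*}
    [TopologicalSpace Y] [ChartedSpace (Coord N × Coord m) Y]
    [IsManifold (IX N) ∞ X] [IsManifold (IY N m) ∞ Y] {π : Y → X} (hπ : IsFibered (N := N) (m := m) π) (cls : WP N EP πP r k → F → Y)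
    (K : Set (InfAut N EG EP G πP r k)) {D : Set Y} {q : ℕ}
    (L : HorizontalForm (N := N) (m := m) π D q N) : Prop :=
  ∀ Φ ∈ K, ∀ Ξ : ProjectableField (N := N) (m := m) π Φ.carrier,
    IsGaugeNaturalLift cls Φ Ξ → IsSymmetry hπ L Ξ

end GaugeNaturalBundles

end GaugeNatural

end

/-! Gauge-naturality makes the lift `Ξ` a symmetry of the Lagrangian, so the theorem reduces to
Noether's theorem for a projectable symmetry, checked along one section `σ` at a time. The pull-back
`(jσ)^*λ` is a form of top degree on the base, so Cartan's formula turns `d(ξ ⌋ (jσ)^*λ)` into its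
Lie derivative along `ξ` (`extDeriv_curryLeft_topForm`, in coordinates). Moving along `ξ` inside the
image of `jσ` differs from following the prolonged field by the prolonged Lie derivative: `T(jσ)ξ =
jΞ ∘ jσ + j(£σ)`. In coordinates this rests on the vertical part of `Ξ` along `σ` being `-£σ`
(`vertPart_apply`). By the chain rule, `d(ξ ⌋ λ) = L_{jΞ}λ + j£σ ⌋ d_V λ` along `σ`, which is
`extD_interiorProd_pullback`. For a symmetry the first summand vanishes. The momentum identity,
applied to the vertical field `£σ`, rewrites the second as `£σ ⌋ E(λ) + d(j£σ ⌋ p)`. Moving the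
exact term to the left gives `dε = £σ ⌋ E(λ)` (`IsSymmetry.zero_eq_add_extD_currentAlong`), and on
critical sections the right-hand side is zero. The remaining work is regularity: all coordinate
expressions must be differentiable, and identities must hold near a point before they can be
differentiated. -/

namespace GaugeNatural

/-! ### Mixed partial derivatives and top-degree forms on coordinate space. -/

section Calculus

variable {N : ℕ} {V : Type*} [NormedAddCommGroup V] [NormedSpace ℝ V]

/-- A mixed partial is a fold of iterated first-order operators, so any property stable under one
derivative passes to it. The binary version below does the same for relations between two functions.
-/
theorem foldr_iterate_induction {ι β : Type*} (T : ι → β → β) (a : ι → ℕ) {p : β → Prop}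
    (hT : ∀ i g, p g → p (T i g)) (l : List ι) {f : β} (hf : p f) :
    p (l.foldr (fun i g => (T i)^[a i] g) f) := by
  induction l with
  | nil => exact hf
  | cons i l ih =>
    rw [List.foldr_cons]
    generalize a i = q
    induction q with
    | zero => exact ih
    | succ q ihq => rw [Function.iterate_succ_apply']; exact hT _ _ ihq

theorem foldr_iterate_induction₂ {ι β : Type*} (T : ι → β → β) (a : ι → ℕ) {p : β → β → Prop}
    (hT : ∀ i g h, p g h → p (T i g) (T i h)) (l : List ι) {f f' : β} (hf : p f f') :
    p (l.foldr (fun i g => (T i)^[a i] g) f) (l.foldr (fun i g => (T i)^[a i] g) f') := by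
  induction l with
  | nil => exact hf
  | cons i l ih =>
    rw [List.foldr_cons, List.foldr_cons]
    generalize a i = q
    induction q with
    | zero => exact ih
    | succ q ihq =>
      rw [Function.iterate_succ_apply', Function.iterate_succ_apply']; exact hT _ _ _ ihq

theorem contDiffAt_mixedPartial (α : Fin N → ℕ) {f : Coord N → V} {u : Coord N}
    (hf : ContDiffAt ℝ ∞ f u) : ContDiffAt ℝ ∞ (mixedPartial α f) u := by
  refine foldr_iterate_induction
    (fun (i : Fin N) (h : Coord N → V) u => fderiv ℝ h u (Pi.single i 1)) α
    (p := fun g => ContDiffAt ℝ ∞ g u) (fun i g hg => ?_) _ hf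
  exact (hg.fderiv_right (m := ∞) (by simp)).clm_apply contDiffAt_const

theorem mixedPartial_congr (α : Fin N → ℕ) {f g : Coord N → V} {u : Coord N}
    (h : f =ᶠ[𝓝 u] g) : mixedPartial α f =ᶠ[𝓝 u] mixedPartial α g := by
  refine foldr_iterate_induction₂
    (fun (i : Fin N) (h : Coord N → V) u => fderiv ℝ h u (Pi.single i 1)) α
    (p := fun f g => f =ᶠ[𝓝 u] g) (fun i f g hfg => ?_) _ h
  filter_upwards [hfg.fderiv (𝕜 := ℝ)] with w hw
  rw [hw]

theorem mixedPartial_neg (α : Fin N → ℕ) (f : Coord N → V) :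
    mixedPartial α (-f) = -mixedPartial α f := by
  refine foldr_iterate_induction₂
    (fun (i : Fin N) (h : Coord N → V) u => fderiv ℝ h u (Pi.single i 1)) α
    (p := fun f g => f = -g) (fun i f g hfg => ?_) _ rfl
  subst hfg
  funext w
  simp [fderiv_neg]

@[simp]
theorem mixedPartial_zeroIdx (q : ℕ) (f : Coord N → V) : mixedPartial (zeroIdx N q).1 f = f := by
  unfold mixedPartial zeroIdx
  induction List.finRange N with
  | nil => rfl
  | cons i l ih => simp

/-- An injective choice of `N` basis vectors among `N` is a permutation, so alternation reduces each
value to the one on the standard frame, up to a sign. -/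
theorem topForm_ext {N : ℕ} {b b' : Coord N [⋀^Fin N]→L[ℝ] ℝ}
    (h : b (fun i => Pi.single i 1) = b' (fun i => Pi.single i 1)) : b = b' := by
  apply ContinuousAlternatingMap.toAlternatingMap_injective
  refine Module.Basis.ext_alternating (Pi.basisFun ℝ (Fin N)) fun v hv => ?_
  let e : Equiv.Perm (Fin N) := Equiv.ofBijective v (Finite.injective_iff_bijective.mp hv)
  have key : ∀ c : Coord N [⋀^Fin N]→L[ℝ] ℝ,
      c.toAlternatingMap (fun i => Pi.basisFun ℝ (Fin N) (v i)) =
        Equiv.Perm.sign e • c (fun i => Pi.single i 1) := by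
    intro c
    have := c.toAlternatingMap.map_perm (fun i => Pi.basisFun ℝ (Fin N) i) e
    simpa [e, Function.comp_def] using this
  rw [key, key, h]

/-- The coordinate form of Cartan's formula for top-degree forms, `d(ξ ⌋ b) = ξ(b) + (div ξ) b`. -/
theorem extDeriv_curryLeft_topForm {n : ℕ}
    {b : Coord (n + 1) → Coord (n + 1) [⋀^Fin (n + 1)]→L[ℝ] ℝ}
    {ξ : Coord (n + 1) → Coord (n + 1)} {u : Coord (n + 1)}
    (hb : DifferentiableAt ℝ b u) (hξ : DifferentiableAt ℝ ξ u) :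
    DifferentiableAt ℝ (fun u => (b u).curryLeft (ξ u)) u ∧
    extDeriv (fun u => (b u).curryLeft (ξ u)) u =
      fderiv ℝ b u (ξ u) + (∑ i, fderiv ℝ ξ u (Pi.single i 1) i) • b u := by
  -- Currying is continuous and linear in the form, so it passes through the derivative of `b`.
  let C := (ContinuousAlternatingMap.curryLeftLI (𝕜 := ℝ) (E := Coord (n + 1)) (F := ℝ)
    (n := n)).toContinuousLinearMap
  have hC : HasFDerivAt (fun u => (b u).curryLeft) (C.comp (fderiv ℝ b u)) u :=
    HasFDerivAt.comp (g := C) u C.hasFDerivAt hb.hasFDerivAt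
  have hd := hC.clm_apply hξ.hasFDerivAt
  refine ⟨hd.differentiableAt, topForm_ext ?_⟩
  set e : Fin (n + 1) → Coord (n + 1) := fun i => Pi.single i 1 with he
  -- The sign in the exterior derivative is exactly the cost of moving `η` from the first slot into
  -- slot `i`. Expanding `η` in the frame, every term except the `i`-th repeats a basis vector and
  -- dies.
  have hins : ∀ (c : Coord (n + 1) [⋀^Fin (n + 1)]→L[ℝ] ℝ) (η : Coord (n + 1))
      (i : Fin (n + 1)), (-1) ^ (i : ℕ) • c.curryLeft η (i.removeNth e) = η i * c e := by
    intro c η i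
    have h1 : (-1) ^ (i : ℕ) • c.curryLeft η (i.removeNth e) = c (Function.update e i η) := by
      have h2 := c.map_insertNth i η (i.removeNth e)
      rw [Fin.insertNth_removeNth] at h2
      exact h2.symm
    rw [h1]
    have h3 : η = ∑ j, η j • e j := by
      funext j; simp [he, Finset.sum_apply, Pi.single_apply]
    conv_lhs => rw [h3]
    have h4 := c.toMultilinearMap.map_update_sum (t := Finset.univ) i (fun j => η j • e j) e
    refine h4.trans ?_
    rw [Finset.sum_eq_single i]
    · simp
    · intro j _ hj
      refine (c.map_update_smul e i (η j) (e j)).trans ?_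
      rw [c.map_eq_zero_of_eq _ (i := i) (j := j) (by simp [hj]) hj.symm, smul_zero]
    · simp
  unfold extDeriv
  rw [hd.fderiv]
  simp only [ContinuousAlternatingMap.alternatizeUncurryFin_apply]
  -- By the product rule, differentiating `ξ` contributes the `i`-th term of the divergence, and
  -- differentiating `b` the `i`-th term of its derivative along `ξ`.
  have hterm : ∀ i : Fin (n + 1), (-1) ^ (i : ℕ) •
      (((b u).curryLeft ∘SL fderiv ℝ ξ u + (C ∘SL fderiv ℝ b u).flip (ξ u)) (e i)) (i.removeNth e) =
      fderiv ℝ ξ u (e i) i * b u e + ξ u i * fderiv ℝ b u (e i) e := by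
    intro i
    rw [← hins, ← hins, ← smul_add]
    rfl
  have hξe : ξ u = ∑ j, ξ u j • e j := by
    funext j; simp [he, Finset.sum_apply, Pi.single_apply]
  have hsum : fderiv ℝ b u (ξ u) e = ∑ i, ξ u i * fderiv ℝ b u (e i) e := by
    conv_lhs => rw [hξe, map_sum]
    simp [ContinuousAlternatingMap.sum_apply]
  refine (Finset.sum_congr rfl fun i _ => hterm i).trans ?_
  rw [Finset.sum_add_distrib, ← hsum, ← Finset.sum_mul, add_comm]
  rfl

end Calculus
-- Smoothness of tangent maps and of vector fields along maps.
theorem SmoothNear.contMDiffAt {E H M E' H' M' : Type*}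
    [NormedAddCommGroup E] [NormedSpace ℝ E] [TopologicalSpace H] {I : ModelWithCorners ℝ E H}
    [TopologicalSpace M] [ChartedSpace H M]
    [NormedAddCommGroup E'] [NormedSpace ℝ E'] [TopologicalSpace H'] {I' : ModelWithCorners ℝ E' H'}
    [TopologicalSpace M'] [ChartedSpace H' M'] {f : M → M'} {x : M} (h : SmoothNear I I' f x) :
    ContMDiffAt I I' ∞ f x := h.self_of_nhds

section Tangent

variable {E H M E' H' M' E'' H'' B : Type*}
  [NormedAddCommGroup E] [NormedSpace ℝ E] [TopologicalSpace H] {I : ModelWithCorners ℝ E H}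
  [TopologicalSpace M] [ChartedSpace H M] [IsManifold I 1 M]
  [NormedAddCommGroup E'] [NormedSpace ℝ E'] [TopologicalSpace H'] {I' : ModelWithCorners ℝ E' H'}
  [TopologicalSpace M'] [ChartedSpace H' M'] [IsManifold I' 1 M']
  [NormedAddCommGroup E''] [NormedSpace ℝ E''] [TopologicalSpace H'']
  {J : ModelWithCorners ℝ E'' H''} [TopologicalSpace B] [ChartedSpace H'' B]

/-- On an open set where `f` is smooth, the tangent map within that set is smooth and agrees with
the unrestricted one. -/
theorem contMDiffAt_tangentMap_comp {f : M → M'} {w : B → TangentBundle I M} {b : B}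
    (hf : SmoothNear I I' f (w b).proj) (hw : ContMDiffAt J I.tangent ∞ w b) :
    ContMDiffAt J I'.tangent ∞ (fun b => tangentMap I I' f (w b)) b := by
  obtain ⟨s, hs, hso, hxs⟩ := eventually_nhds_iff.1 hf
  have hfs : ContMDiffOn I I' ∞ f s := fun y hy => (hs y hy).contMDiffWithinAt
  have hT := hfs.contMDiffOn_tangentMapWithin (m := ∞) (by simp) hso.uniqueMDiffOn
  have hopen : IsOpen (Bundle.TotalSpace.proj ⁻¹' s : Set (TangentBundle I M)) :=
    hso.preimage (FiberBundle.continuous_proj E (TangentSpace I))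
  have hT' : ContMDiffAt I.tangent I'.tangent ∞ (tangentMap I I' f) (w b) := by
    refine (hT.contMDiffAt (hopen.mem_nhds hxs)).congr_of_eventuallyEq ?_
    filter_upwards [hopen.mem_nhds hxs] with p hp
    exact (tangentMapWithin_eq_tangentMap (hso.uniqueMDiffOn _ hp)
      ((hs _ hp).mdifferentiableAt (by simp))).symm
  exact hT'.comp b hw

/-- Both fields lie over the same map, so a local trivialization, being linear on fibres, turns
their difference into a difference of vector-valued functions. -/
theorem contMDiffAt_sub_along {f : B → M} {v w : ∀ b, TangentSpace I (f b)} {b : B}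
    (hv : ContMDiffAt J I.tangent ∞ (fun b => (⟨f b, v b⟩ : TangentBundle I M)) b)
    (hw : ContMDiffAt J I.tangent ∞ (fun b => (⟨f b, w b⟩ : TangentBundle I M)) b) :
    ContMDiffAt J I.tangent ∞ (fun b => (⟨f b, v b - w b⟩ : TangentBundle I M)) b := by
  have hv' := Bundle.contMDiffAt_totalSpace.1 hv
  have hw' := Bundle.contMDiffAt_totalSpace.1 hw
  refine Bundle.contMDiffAt_totalSpace.2 ⟨hv'.1, (hv'.2.sub hw'.2).congr_of_eventuallyEq ?_⟩
  have hmem := hv'.1.continuousAt.preimage_mem_nhds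
    ((trivializationAt E (TangentSpace I) (f b)).open_baseSet.mem_nhds
      (FiberBundle.mem_baseSet_trivializationAt' (f b)))
  filter_upwards [hmem] with b' hb'
  exact ((trivializationAt E (TangentSpace I) (f b)).linear ℝ hb').map_sub _ _

theorem contDiffAt_mfderiv_along {V W : Type*} [NormedAddCommGroup V] [NormedSpace ℝ V]
    [NormedAddCommGroup W] [NormedSpace ℝ W] {f : M → V} {w : W → TangentBundle I M} {u : W}
    (hf : SmoothNear I 𝓘(ℝ, V) f (w u).proj) (hw : ContMDiffAt 𝓘(ℝ, W) I.tangent ∞ w u) :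
    ContDiffAt ℝ ∞ (fun u => (show V from mfderiv I 𝓘(ℝ, V) f (w u).proj (w u).2)) u := by
  rw [← contMDiffAt_iff_contDiffAt]
  have h1 := contMDiffAt_tangentMap_comp hf hw
  exact (contMDiff_snd_tangentBundle_modelSpace V 𝓘(ℝ, V)).contMDiffAt.comp u h1

theorem smoothNear_of_mem_maximalAtlas {M : Type*} [TopologicalSpace M] [ChartedSpace E M]
    {e : OpenPartialHomeomorph M E} (he : e ∈ IsManifold.maximalAtlas 𝓘(ℝ, E) ∞ M) {x : M}
    (hx : x ∈ e.source) : SmoothNear 𝓘(ℝ, E) 𝓘(ℝ, E) e x := by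
  filter_upwards [e.open_source.mem_nhds hx] with y hy
  exact contMDiffAt_of_mem_maximalAtlas he hy

end Tangent

/-! ### Coordinate expressions of sections, jets and vertical fields. -/

section Sections

variable {N m : ℕ} {X Y : Type*}
  [TopologicalSpace X] [ChartedSpace (Coord N) X]
  [TopologicalSpace Y] [ChartedSpace (Coord N × Coord m) Y]
  {π : Y → X} (κ : AdaptedChart (N := N) (m := m) π)

theorem IsSectionAt.eventually {x : X} {σ : X → Y}
    (h : IsSectionAt (IX N) (IY N m) π x σ) :
    ∀ᶠ x' in 𝓝 x, IsSectionAt (IX N) (IY N m) π x' σ :=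
  h.1.eventually_nhds.and h.2.eventually_nhds

namespace AdaptedChart

variable {κ} {x : X} {σ : X → Y} {D : Set Y}

theorem base_mem_source (h : IsSectionAt (IX N) (IY N m) π x σ) (hσ : σ x ∈ κ.total.source) :
    x ∈ κ.base.source := h.2.self_of_nhds ▸ κ.mapsTo _ hσ

theorem contMDiffAt_symm (hx : x ∈ κ.base.source) :
    ContMDiffAt 𝓘(ℝ, Coord N) (IX N) ∞ κ.base.symm (κ.base x) :=
  contMDiffAt_symm_of_mem_maximalAtlas κ.base_mem (κ.base.map_source hx)

/-- Properties that hold near `x` hold near the coordinates of `x`. -/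
theorem eventually_symm (hx : x ∈ κ.base.source) {p : X → Prop} (hp : ∀ᶠ x' in 𝓝 x, p x') :
    ∀ᶠ u in 𝓝 (κ.base x), u ∈ κ.base.target ∧ p (κ.base.symm u) := by
  filter_upwards [κ.base.open_target.mem_nhds (κ.base.map_source hx),
    (κ.base.tendsto_symm hx).eventually hp] with u hu hpu using ⟨hu, hpu⟩

theorem contDiffAt_total (h : IsSectionAt (IX N) (IY N m) π x σ) (hσ : σ x ∈ κ.total.source) :
    ContDiffAt ℝ ∞ (fun u => κ.total (σ (κ.base.symm u))) (κ.base x) := by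
  have hx := base_mem_source h hσ
  rw [← contMDiffAt_iff_contDiffAt]
  have h1 : ContMDiffAt (IX N) (IY N m) ∞ (fun x => κ.total (σ x)) x :=
    (contMDiffAt_of_mem_maximalAtlas κ.total_mem hσ).comp x h.1.contMDiffAt
  refine ContMDiffAt.comp (κ.base x) (g := fun x => κ.total (σ x)) ?_ (contMDiffAt_symm hx)
  rwa [κ.base.left_inv hx]

theorem contDiffAt_sec (h : IsSectionAt (IX N) (IY N m) π x σ) (hσ : σ x ∈ κ.total.source) :
    ContDiffAt ℝ ∞ (κ.sec σ) (κ.base x) := contDiffAt_snd.comp _ (contDiffAt_total h hσ)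

theorem contDiffAt_jet (h : IsSectionAt (IX N) (IY N m) π x σ) (hσ : σ x ∈ κ.total.source)
    (q : ℕ) : ContDiffAt ℝ ∞ (κ.jet q σ) (κ.base x) :=
  contDiffAt_id.prodMk (contDiffAt_pi.2 fun α => contDiffAt_mixedPartial α.1 (contDiffAt_sec h hσ))

theorem isOpen_jetDomain (hD : IsOpen D) (q : ℕ) : IsOpen (κ.jetDomain D q) := by
  have hc : Continuous fun z : JetCoord N m q => (z.1, z.2 (zeroIdx N q)) := by fun_prop
  exact (κ.total.isOpen_inter_preimage_symm hD).preimage hc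

/-- The zero multi-index recovers the fibre coordinates of `σ x`, and adaptedness of the chart
supplies the base coordinates, so the order-zero part of the jet is `κ.total (σ x)`. -/
theorem jet_mem_jetDomain (h : IsSectionAt (IX N) (IY N m) π x σ) (hσ : σ x ∈ κ.total.source)
    (hσD : σ x ∈ D) (q : ℕ) : κ.jet q σ (κ.base x) ∈ κ.jetDomain D q := by
  have hx := base_mem_source h hσ
  have key : ((κ.jet q σ (κ.base x)).1, (κ.jet q σ (κ.base x)).2 (zeroIdx N q)) =
      κ.total (σ x) := by
    have h1 := κ.adapted _ hσ
    rw [h.2.self_of_nhds] at h1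
    refine Prod.ext h1.symm ?_
    simp only [jet, mixedPartial_zeroIdx, sec, κ.base.left_inv hx]
  refine ⟨?_, ?_⟩
  · rw [key]; exact κ.total.map_source hσ
  · rw [key, κ.total.left_inv hσ]; exact hσD

variable [IsManifold (IY N m) ∞ Y]

theorem contDiffAt_vertSec {v : X → TangentBundle (IY N m) Y} (hx : x ∈ κ.base.source)
    (hσ : (v x).proj ∈ κ.total.source)
    (hv : ContMDiffAt (IX N) (IY N m).tangent ∞ v x) :
    ContDiffAt ℝ ∞ (κ.vertSec v) (κ.base x) := by
  refine contDiffAt_snd.comp (κ.base x) (contDiffAt_mfderiv_along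
    (w := fun u => v (κ.base.symm u)) (smoothNear_of_mem_maximalAtlas κ.total_mem ?_) ?_)
  · rwa [κ.base.left_inv hx]
  · refine ContMDiffAt.comp (κ.base x) (g := v) ?_ (contMDiffAt_symm hx)
    rwa [κ.base.left_inv hx]

end AdaptedChart

end Sections

/-! ### Coordinate expressions of forms and their exterior derivative. -/

section Forms

variable {N m : ℕ} {X Y : Type*}
  [TopologicalSpace X] [ChartedSpace (Coord N) X]
  [TopologicalSpace Y] [ChartedSpace (Coord N × Coord m) Y]
  {π : Y → X}

theorem ofCoord_add {p : ℕ} (c : OpenPartialHomeomorph X (Coord N)) (x : X)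
    (b b' : Coord N [⋀^Fin p]→L[ℝ] ℝ) :
    ofCoord c x (b + b') = ofCoord c x b + ofCoord c x b' := rfl

theorem ofCoord_neg {p : ℕ} (c : OpenPartialHomeomorph X (Coord N)) (x : X)
    (b : Coord N [⋀^Fin p]→L[ℝ] ℝ) : ofCoord c x (-b) = -ofCoord c x b := rfl

theorem interiorProd_ofCoord {p : ℕ} (c : OpenPartialHomeomorph X (Coord N)) (x : X)
    (v : TangentSpace (IX N) x) (b : Coord N [⋀^Fin (p + 1)]→L[ℝ] ℝ) :
    interiorProd v (ofCoord c x b) =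
      ofCoord c x (b.curryLeft (mfderiv (IX N) 𝓘(ℝ, Coord N) c x v)) := by
  refine ContinuousAlternatingMap.ext fun w => congrArg b ?_
  funext i
  refine Fin.cases rfl (fun j => rfl) i

/-- The exterior derivative computed from a coordinate expression in the chart at the point. -/
theorem extD_eq_ofCoord [IsManifold (IX N) ∞ X] {p : ℕ} {β : ∀ x : X, Alt N p x} {x : X}
    {c : OpenPartialHomeomorph X (Coord N)} (hc : c = chartAt (Coord N) x)
    {B : Coord N → Coord N [⋀^Fin p]→L[ℝ] ℝ}
    (h : ∀ᶠ x' in 𝓝 x, β x' = ofCoord c x' (B (c x'))) :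
    extD β x = ofCoord c x (extDeriv B (c x)) := by
  subst hc
  have hx := mem_chart_source (Coord N) x
  set c := chartAt (Coord N) x
  unfold extD
  congr 1
  refine Filter.EventuallyEq.extDeriv_eq ?_
  filter_upwards [c.open_target.mem_nhds (c.map_source hx),
    (c.tendsto_symm hx).eventually h] with u hu hβ
  -- Pulling `ofCoord c` back by the inverse chart cancels the two derivatives and leaves `B`
  -- itself.
  have hcomp := (mdifferentiable_chart (I := IX N) x).comp_symm_deriv hu
  rw [hβ, c.right_inv hu]
  refine ContinuousAlternatingMap.ext fun w => congrArg (B u) ?_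
  funext i
  exact congrArg (fun A : Coord N →L[ℝ] Coord N => A (w i)) hcomp

variable {κ : AdaptedChart (N := N) (m := m) π} {x : X} {σ : X → Y} {D : Set Y}

/-- The second part matters for `extD`, which is computed in the preferred chart at `x`: the chart
used for the variational expressions lies over that same chart, so no change of coordinates is
needed. -/
theorem IsFibered.chart_spec (hπ : IsFibered (N := N) (m := m) π)
    (h : π (σ x) = x) : σ x ∈ (hπ.chart (σ x)).total.source ∧
      (hπ.chart (σ x)).base = chartAt (Coord N) x := by
  have := (hπ.exists_chart (σ x)).choose_spec
  exact ⟨this.1, this.2.trans (by rw [h])⟩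

theorem HorizontalForm.pullback_eq_ofCoord {q p : ℕ}
    (β : HorizontalForm (N := N) (m := m) π D q p)
    (h : IsSectionAt (IX N) (IY N m) π x σ) (hσ : σ x ∈ κ.total.source) (hσD : σ x ∈ D) :
    β.pullback σ x = ofCoord κ.base x (β.coord κ (κ.jet q σ (κ.base x))) := by
  rw [pullback, dif_pos h]
  exact (β.smooth κ).choose_spec.2 x σ h hσ hσD

theorem HorizontalForm.contDiffAt_coord (hD : IsOpen D) {q p : ℕ}
    (β : HorizontalForm (N := N) (m := m) π D q p)
    (h : IsSectionAt (IX N) (IY N m) π x σ) (hσ : σ x ∈ κ.total.source) (hσD : σ x ∈ D) :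
    ContDiffAt ℝ ∞ (β.coord κ) (κ.jet q σ (κ.base x)) :=
  (β.smooth κ).choose_spec.1.contDiffAt
    ((AdaptedChart.isOpen_jetDomain hD q).mem_nhds
      (AdaptedChart.jet_mem_jetDomain h hσ hσD q))

theorem eventually_section_mem (hD : IsOpen D)
    (h : IsSectionAt (IX N) (IY N m) π x σ) (hσ : σ x ∈ κ.total.source) (hσD : σ x ∈ D) :
    ∀ᶠ x' in 𝓝 x, IsSectionAt (IX N) (IY N m) π x' σ ∧ σ x' ∈ κ.total.source ∧ σ x' ∈ D :=
  h.eventually.and (h.1.contMDiffAt.continuousAt.eventually_mem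
    ((κ.total.open_source.inter hD).mem_nhds ⟨hσ, hσD⟩))

variable [IsManifold (IY N m) ∞ Y]

theorem IsVerticalAlong.eventually {v : X → TangentBundle (IY N m) Y}
    (h : IsVerticalAlong π x σ v) : ∀ᶠ x' in 𝓝 x, IsVerticalAlong π x' σ v :=
  (h.1.1.eventually_nhds.and h.1.2.eventually_nhds).and h.2.eventually_nhds

/-- The contraction of a contact form with a vertical field along a section has a differentiable
coordinate expression. -/
theorem ContactForm.exists_contract_eq_ofCoord (hD : IsOpen D) {a b k : ℕ}
    (p : ContactForm (N := N) (m := m) π D a b k) {v : X → TangentBundle (IY N m) Y}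
    (h : IsSectionAt (IX N) (IY N m) π x σ) (hv : IsVerticalAlong π x σ v)
    (hσ : σ x ∈ κ.total.source) (hσD : σ x ∈ D) :
    ∃ B : Coord N → Coord N [⋀^Fin k]→L[ℝ] ℝ, DifferentiableAt ℝ B (κ.base x) ∧
      ∀ᶠ x' in 𝓝 x, p.contract σ v x' = ofCoord κ.base x' (B (κ.base x')) := by
  obtain ⟨Q, hQ, hpQ⟩ := p.smooth κ
  refine ⟨fun u => Q (κ.jet a σ u) fun α => mixedPartial α.1 (κ.vertSec v) u, ?_, ?_⟩
  · have h1 : ContDiffAt ℝ ∞ (fun u => Q (κ.jet a σ u)) (κ.base x) :=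
      ContDiffAt.comp (κ.base x) (hQ.contDiffAt
        ((AdaptedChart.isOpen_jetDomain hD a).mem_nhds
          (AdaptedChart.jet_mem_jetDomain h hσ hσD a))) (AdaptedChart.contDiffAt_jet h hσ a)
    have hvσ : (v x).proj = σ x := hv.2.self_of_nhds.1
    have h2 : ContDiffAt ℝ ∞ (κ.vertSec v) (κ.base x) :=
      AdaptedChart.contDiffAt_vertSec (AdaptedChart.base_mem_source h hσ)
        (hvσ.symm ▸ hσ) hv.1.1.contMDiffAt
    exact (h1.clm_apply (contDiffAt_pi.2 fun α => contDiffAt_mixedPartial α.1 h2)).differentiableAt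
      (by simp)
  -- Being a section and being vertical along it are open conditions, so the default value `0` in
  -- `contract` does not occur near `x`.
  · filter_upwards [eventually_section_mem hD h hσ hσD, hv.eventually] with x' hx' hv'
    rw [contract, dif_pos ⟨hx'.1, hv'⟩]
    exact hpQ x' σ v hx'.1 hv' hx'.2.1 hx'.2.2

end Forms

/-! ### The generalized Lie derivative of a section and its coordinates. -/

section Lift

variable {N m : ℕ} {X Y : Type*}
  [TopologicalSpace X] [ChartedSpace (Coord N) X] [IsManifold (IX N) ∞ X]
  [TopologicalSpace Y] [ChartedSpace (Coord N × Coord m) Y] [IsManifold (IY N m) ∞ Y]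
  {π : Y → X} {κ : AdaptedChart (N := N) (m := m) π} {x : X} {σ : X → Y} {V : Set X}

namespace ProjectableField

variable (Ξ : ProjectableField (N := N) (m := m) π V)

theorem contMDiffAt_lieSec (hV : IsOpen V) (hπ : ContMDiff (IY N m) (IX N) ∞ π) (hx : x ∈ V)
    (h : IsSectionAt (IX N) (IY N m) π x σ) :
    ContMDiffAt (IX N) (IY N m).tangent ∞ (Ξ.lieSec σ) x := by
  refine contMDiffAt_sub_along (f := σ)
    (v := fun x => mfderiv (IX N) (IY N m) σ x (Ξ.base x)) (w := fun x => Ξ.total (σ x)) ?_ ?_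
  · exact contMDiffAt_tangentMap_comp (w := fun x => (⟨x, Ξ.base x⟩ : TangentBundle (IX N) X)) h.1
      (Ξ.smooth_base.contMDiffAt (hV.mem_nhds hx))
  · have hσx : σ x ∈ π ⁻¹' V := by
      rw [Set.mem_preimage, h.2.self_of_nhds]; exact hx
    exact (Ξ.smooth_total.contMDiffAt ((hV.preimage hπ.continuous).mem_nhds hσx)).comp x
      h.1.contMDiffAt

/-- Differentiating `π ∘ σ = id` gives `Tπ(Tσ ξ) = ξ`, and projectability gives `Tπ Ξ = ξ`; the two
cancel. -/
theorem mfderiv_proj_lieSec (hπ : ContMDiff (IY N m) (IX N) ∞ π) (hx : x ∈ V)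
    (h : IsSectionAt (IX N) (IY N m) π x σ) :
    mfderiv (IY N m) (IX N) π (σ x) (Ξ.lieSec σ x).2 = 0 := by
  have hπσ : π (σ x) = x := h.2.self_of_nhds
  have hcomp : HasMFDerivAt (IX N) (IX N) (π ∘ σ) x
      ((mfderiv (IY N m) (IX N) π (σ x)).comp (mfderiv (IX N) (IY N m) σ x)) :=
    ((hπ (σ x)).mdifferentiableAt (by simp)).hasMFDerivAt.comp x
      (h.1.contMDiffAt.mdifferentiableAt (by simp)).hasMFDerivAt
  have hid : HasMFDerivAt (IX N) (IX N) (π ∘ σ) x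
      (ContinuousLinearMap.id ℝ (TangentSpace (IX N) x)) :=
    (hasMFDerivAt_id x).congr_of_eventuallyEq h.2
  have heq := hasMFDerivAt_unique hcomp hid
  have hbase : (Ξ.base (π (σ x)) : Coord N) = Ξ.base x := by rw [hπσ]
  refine (map_sub (mfderiv (IY N m) (IX N) π (σ x)) _ _).trans ?_
  refine sub_eq_zero.2 ?_
  refine Eq.trans (congrArg (fun A : Coord N →L[ℝ] Coord N => A (Ξ.base x)) heq) ?_
  rw [Ξ.proj (σ x) (by rw [Set.mem_preimage, hπσ]; exact hx)]
  exact hbase.symm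

theorem isVerticalAlong_lieSec (hV : IsOpen V) (hπ : ContMDiff (IY N m) (IX N) ∞ π)
    (hx : x ∈ V) (h : IsSectionAt (IX N) (IY N m) π x σ) :
    IsVerticalAlong π x σ (Ξ.lieSec σ) := by
  -- The field at `x'` is based at `σ x'`, so its projection to the base is that of `σ`.
  refine ⟨⟨?_, h.2⟩, ?_⟩
  · filter_upwards [hV.mem_nhds hx, h.eventually] with x' hx' h'
    exact Ξ.contMDiffAt_lieSec hV hπ hx' h'
  · filter_upwards [hV.mem_nhds hx, h.eventually] with x' hx' h'
    exact ⟨rfl, Ξ.mfderiv_proj_lieSec hπ hx' h'⟩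

theorem contDiffAt_baseCoord (hV : IsOpen V) (hx : x ∈ V) (hκ : x ∈ κ.base.source) :
    ContDiffAt ℝ ∞ (Ξ.baseCoord κ) (κ.base x) := by
  refine contDiffAt_mfderiv_along
    (w := fun u => (⟨κ.base.symm u, Ξ.base (κ.base.symm u)⟩ : TangentBundle (IX N) X))
    (smoothNear_of_mem_maximalAtlas κ.base_mem ?_) ?_
  · rwa [κ.base.left_inv hκ]
  · refine ContMDiffAt.comp (κ.base x)
      (g := fun x => (⟨x, Ξ.base x⟩ : TangentBundle (IX N) X)) ?_
      (AdaptedChart.contMDiffAt_symm hκ)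
    rw [κ.base.left_inv hκ]
    exact Ξ.smooth_base.contMDiffAt (hV.mem_nhds hx)

theorem baseCoord_apply (hκ : x ∈ κ.base.source) :
    Ξ.baseCoord κ (κ.base x) = mfderiv (IX N) 𝓘(ℝ, Coord N) κ.base x (Ξ.base x) := by
  rw [baseCoord, κ.base.left_inv hκ]

/-- The sign comes from opposite conventions: `vertPart` is `Ξ - Tσ ξ` in fibre coordinates,
`lieSec` is `Tσ ξ - Ξ`. The chain rule identifies `y^i_μ ξ^μ` with the fibre components of `Tσ ξ`.
-/
theorem vertPart_apply (h : IsSectionAt (IX N) (IY N m) π x σ) (hσ : σ x ∈ κ.total.source) :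
    Ξ.vertPart κ σ (κ.base x) = -κ.vertSec (Ξ.lieSec σ) (κ.base x) := by
  have hκ := AdaptedChart.base_mem_source h hσ
  have hbase : HasMFDerivAt (IX N) 𝓘(ℝ, Coord N) κ.base x _ :=
    ((smoothNear_of_mem_maximalAtlas κ.base_mem hκ).contMDiffAt.mdifferentiableAt
      (by simp)).hasMFDerivAt
  have htot : HasMFDerivAt (IY N m) 𝓘(ℝ, Coord N × Coord m) κ.total (σ x) _ :=
    ((smoothNear_of_mem_maximalAtlas κ.total_mem hσ).contMDiffAt.mdifferentiableAt
      (by simp)).hasMFDerivAt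
  have hσd : HasMFDerivAt (IX N) (IY N m) σ x _ :=
    (h.1.contMDiffAt.mdifferentiableAt (by simp)).hasMFDerivAt
  have hsec : HasMFDerivAt 𝓘(ℝ, Coord N) 𝓘(ℝ, Coord m) (κ.sec σ) (κ.base x) _ :=
    ((AdaptedChart.contDiffAt_sec h hσ).differentiableAt (by simp)).hasFDerivAt.hasMFDerivAt
  have hsnd : HasMFDerivAt 𝓘(ℝ, Coord N × Coord m) 𝓘(ℝ, Coord m) Prod.snd (κ.total (σ x)) _ :=
    (hasFDerivAt_snd (𝕜 := ℝ) (p := κ.total (σ x))).hasMFDerivAt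
  have h1 := hsec.comp x hbase
  have h2 := hsnd.comp x (htot.comp x hσd)
  have heq : κ.sec σ ∘ κ.base =ᶠ[𝓝 x] Prod.snd ∘ (κ.total ∘ σ) := by
    filter_upwards [κ.base.open_source.mem_nhds hκ] with x' hx'
    simp only [AdaptedChart.sec, Function.comp_apply, κ.base.left_inv hx']
  have h3 := hasMFDerivAt_unique h1 (h2.congr_of_eventuallyEq heq)
  have h4 : fderiv ℝ (κ.sec σ) (κ.base x) (Ξ.baseCoord κ (κ.base x)) =
      κ.vert ⟨σ x, mfderiv (IX N) (IY N m) σ x (Ξ.base x)⟩ := by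
    rw [Ξ.baseCoord_apply hκ]
    exact congrArg (fun A : Coord N →L[ℝ] Coord m => A (Ξ.base x)) h3
  have h5 : κ.vertSec (Ξ.lieSec σ) (κ.base x) =
      κ.vert ⟨σ x, mfderiv (IX N) (IY N m) σ x (Ξ.base x)⟩ - κ.vert ⟨σ x, Ξ.total (σ x)⟩ := by
    rw [AdaptedChart.vertSec, κ.base.left_inv hκ]
    exact congrArg Prod.snd (map_sub (mfderiv (IY N m) 𝓘(ℝ, Coord N × Coord m) κ.total (σ x)) _ _)
  rw [vertPart, h4, h5, κ.base.left_inv hκ, neg_sub]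

/-- Equality of germs, rather than of values, is what allows mixed partials of both sides to be
compared. -/
theorem vertPart_eventuallyEq (h : IsSectionAt (IX N) (IY N m) π x σ)
    (hσ : σ x ∈ κ.total.source) :
    Ξ.vertPart κ σ =ᶠ[𝓝 (κ.base x)] -κ.vertSec (Ξ.lieSec σ) := by
  have hκ := AdaptedChart.base_mem_source h hσ
  filter_upwards [AdaptedChart.eventually_symm hκ
    (eventually_section_mem isOpen_univ h hσ (Set.mem_univ _))] with u hu
  have := Ξ.vertPart_apply hu.2.1 hu.2.2.1
  rwa [κ.base.right_inv hu.1] at this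

end ProjectableField

end Lift

/-! ### The first variation formula and conservation of the current. -/

section Noether

variable {n m : ℕ} {X Y : Type*}
  [TopologicalSpace X] [ChartedSpace (Coord (n + 1)) X] [IsManifold (IX (n + 1)) ∞ X]
  [TopologicalSpace Y] [ChartedSpace (Coord (n + 1) × Coord m) Y] [IsManifold (IY (n + 1) m) ∞ Y]
  {π : Y → X} {D : Set Y} {V : Set X} {x : X} {σ : X → Y}

/-- Cartan's formula and the first variation: along a section `σ`,
`d(ξ ⌋ λ) = L_{jΞ} λ + j£_Ξ σ ⌋ d_V λ`. -/
theorem extD_interiorProd_pullback (hπ : IsFibered (N := n + 1) (m := m) π) (hD : IsOpen D)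
    (hV : IsOpen V) {q : ℕ} (L : HorizontalForm (N := n + 1) (m := m) π D q (n + 1))
    (Ξ : ProjectableField (N := n + 1) (m := m) π V) (hx : x ∈ V)
    (h : IsSectionAt (IX (n + 1)) (IY (n + 1) m) π x σ) (hσD : σ x ∈ D) :
    ∃ B : Coord (n + 1) → Coord (n + 1) [⋀^Fin n]→L[ℝ] ℝ,
      DifferentiableAt ℝ B ((hπ.chart (σ x)).base x) ∧
      (∀ᶠ x' in 𝓝 x, interiorProd (Ξ.base x') (L.pullback σ x') =
        ofCoord (hπ.chart (σ x)).base x' (B ((hπ.chart (σ x)).base x'))) ∧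
      ofCoord (hπ.chart (σ x)).base x (extDeriv B ((hπ.chart (σ x)).base x)) =
        lieDeriv hπ Ξ L σ x + dVert hπ L σ (Ξ.lieSec σ) x := by
  have hσ := (hπ.chart_spec h.2.self_of_nhds).1
  unfold lieDeriv dVert
  -- The computation works in any adapted chart whose domain contains `σ x`.
  generalize hπ.chart (σ x) = κ at hσ ⊢
  have hκ := AdaptedChart.base_mem_source h hσ
  have hjet := (AdaptedChart.contDiffAt_jet h hσ q).differentiableAt (by simp)
  have hL := (L.contDiffAt_coord hD h hσ hσD).differentiableAt (by simp)
  have hξ := (Ξ.contDiffAt_baseCoord hV hx hκ).differentiableAt (by simp)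
  have hLjet : HasFDerivAt (fun u => L.coord κ (κ.jet q σ u)) _ (κ.base x) :=
    HasFDerivAt.comp (g := L.coord κ) (κ.base x) hL.hasFDerivAt hjet.hasFDerivAt
  obtain ⟨hB, hdB⟩ := extDeriv_curryLeft_topForm hLjet.differentiableAt hξ
  refine ⟨_, hB, ?_, ?_⟩
  · filter_upwards [eventually_section_mem hD h hσ hσD] with x' hx'
    rw [L.pullback_eq_ofCoord hx'.1 hx'.2.1 hx'.2.2, interiorProd_ofCoord,
      Ξ.baseCoord_apply (AdaptedChart.base_mem_source hx'.1 hx'.2.1)]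
  · rw [hdB, ← ofCoord_add, hLjet.fderiv]
    congr 1
    -- The divergence terms agree on both sides. What remains is to split the argument of `dL`: the
    -- derivative of `jσ` along `ξ` must be the prolongation of `Ξ` plus `(0, ∂_α £σ)`. The
    -- prolongation already contains the derivative of `∂_α σ` along `ξ`, so only its vertical part
    -- has to cancel.
    rw [add_right_comm, ContinuousLinearMap.comp_apply, ← map_add]
    congr 2
    have hderiv : fderiv ℝ (κ.jet q σ) (κ.base x) (Ξ.baseCoord κ (κ.base x)) =
        (Ξ.baseCoord κ (κ.base x), fun α => fderiv ℝ (mixedPartial α.1 (κ.sec σ)) (κ.base x)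
          (Ξ.baseCoord κ (κ.base x))) := by
      have hα : ∀ α : MultiIdx (n + 1) q, HasFDerivAt (mixedPartial α.1 (κ.sec σ)) _ (κ.base x) :=
        fun α => ((contDiffAt_mixedPartial α.1 (AdaptedChart.contDiffAt_sec h hσ)).differentiableAt
          (by simp)).hasFDerivAt
      have hj : HasFDerivAt (κ.jet q σ) _ (κ.base x) :=
        (hasFDerivAt_id (𝕜 := ℝ) (κ.base x)).prodMk (hasFDerivAt_pi.2 hα)
      rw [hj.fderiv]
      rfl
    have hvert : ∀ α : MultiIdx (n + 1) q, mixedPartial α.1 (Ξ.vertPart κ σ) (κ.base x) =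
        -mixedPartial α.1 (κ.vertSec (Ξ.lieSec σ)) (κ.base x) := fun α => by
      rw [(mixedPartial_congr α.1 (Ξ.vertPart_eventuallyEq h hσ)).eq_of_nhds, mixedPartial_neg,
        Pi.neg_apply]
    rw [hderiv]
    refine Prod.ext (add_zero _).symm (funext fun α => ?_)
    simp [ProjectableField.prolong, hvert]

/-- The first variation formula for a symmetry: `0 = -£_Ξ σ ⌋ E(λ) + d ε` along each section. -/
theorem IsSymmetry.zero_eq_add_extD_currentAlong (hπ : IsFibered (N := n + 1) (m := m) π)
    (hD : IsOpen D) (hV : IsOpen V) {q a b : ℕ}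
    {L : HorizontalForm (N := n + 1) (m := m) π D q (n + 1)}
    {p : ContactForm (N := n + 1) (m := m) π D a b n} (hp : IsMomentum hπ L p)
    {Ξ : ProjectableField (N := n + 1) (m := m) π V} (hΞ : IsSymmetry hπ L Ξ) (hx : x ∈ V)
    (h : IsSectionAt (IX (n + 1)) (IY (n + 1) m) π x σ) (hσD : σ x ∈ D) :
    0 = -eulerLagrange hπ L σ (Ξ.lieSec σ x) x + extD (currentAlong L p Ξ σ) x := by
  obtain ⟨hσ, hchart⟩ := hπ.chart_spec h.2.self_of_nhds
  have hv := Ξ.isVerticalAlong_lieSec hV hπ.smooth hx h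
  obtain ⟨B, hB, hBeq, hBd⟩ := extD_interiorProd_pullback hπ hD hV L Ξ hx h hσD
  obtain ⟨Q, hQ, hQeq⟩ := p.exists_contract_eq_ofCoord hD h hv hσ hσD
  have hcur : extD (currentAlong L p Ξ σ) x =
      -extD (p.contract σ (Ξ.lieSec σ)) x + dVert hπ L σ (Ξ.lieSec σ) x := by
    -- Both pieces of the current are expressed in one chart by differentiable functions, which
    -- makes the exterior derivative additive here.
    have hsum : ∀ᶠ x' in 𝓝 x, currentAlong L p Ξ σ x' =
        ofCoord (hπ.chart (σ x)).base x' ((-Q + B) ((hπ.chart (σ x)).base x')) := by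
      filter_upwards [hBeq, hQeq] with x' h1 h2
      rw [currentAlong, h1, h2]
      rfl
    have hneg : extDeriv (-Q) ((hπ.chart (σ x)).base x) =
        -extDeriv Q ((hπ.chart (σ x)).base x) := by
      have := extDeriv_smul (-1 : ℝ) Q (x := (hπ.chart (σ x)).base x)
      simpa using this
    rw [extD_eq_ofCoord hchart hsum, extD_eq_ofCoord hchart hQeq, extDeriv_add hQ.neg hB, hneg,
      ofCoord_add, ofCoord_neg, hBd, hΞ x hx σ h hσD, zero_add]
  -- Integration by parts for `£σ`: the Euler–Lagrange terms and the differentials of the momentum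
  -- term cancel in pairs.
  rw [hcur, hp x σ _ h hv hσD]
  abel

end Noether

end GaugeNatural

/-! ### Noether's theorem for gauge-natural Lagrangians. -/

open GaugeNatural in
theorem mainTheorem4 {n m r k s : ℕ} {EG EP G X P F Y : Type*}
    [NormedAddCommGroup EG] [NormedSpace ℝ EG] [FiniteDimensional ℝ EG]
    [NormedAddCommGroup EP] [NormedSpace ℝ EP] [FiniteDimensional ℝ EP]
    [TopologicalSpace G] [ChartedSpace EG G] [Group G] [LieGroup 𝓘(ℝ, EG) ∞ G]
    [TopologicalSpace X] [ChartedSpace (Coord (n + 1)) X] [IsManifold (IX (n + 1)) ∞ X]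
    [TopologicalSpace P] [ChartedSpace EP P] [IsManifold 𝓘(ℝ, EP) ∞ P] [MulAction Gᵐᵒᵖ P]
    [TopologicalSpace F] [ChartedSpace (Coord m) F] [IsManifold 𝓘(ℝ, Coord m) ∞ F]
    [TopologicalSpace Y] [ChartedSpace (Coord (n + 1) × Coord m) Y]
    [IsManifold (IY (n + 1) m) ∞ Y]
    (πP : P → X) (hP : IsPrincipalBundle (n + 1) EG EP G πP) (hrk : r ≤ k)
    (ζ : WG (n + 1) EG G r k → F → F) (hζ : IsLeftAction (m := m) ζ)
    (cls : WP (n + 1) EP πP r k → F → Y) (π : Y → X) (hY : IsAssociatedBundle (m := m) ζ cls π)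
    (D : Set Y) (hD : IsOpen D)
    (L : HorizontalForm (N := n + 1) (m := m) π D (s + 1) (n + 1))
    (p : ContactForm (N := n + 1) (m := m) π D (2 * s + 1) s n)
    (hp : IsMomentum hY.fibered L p)
    (K : Set (InfAut (n + 1) EG EP G πP r k)) (hL : IsGaugeNatural hY.fibered cls K L)
    (Φ : InfAut (n + 1) EG EP G πP r k) (hΦ : Φ ∈ K)
    (Ξ : ProjectableField (N := n + 1) (m := m) π Φ.carrier)
    (hΞ : IsGaugeNaturalLift cls Φ Ξ) :
    (∀ x ∈ Φ.carrier, ∀ σ : X → Y,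
      IsSectionAt (IX (n + 1)) (IY (n + 1) m) π x σ → σ x ∈ D →
        0 = -eulerLagrange hY.fibered L σ (Ξ.lieSec σ x) x + extD (currentAlong L p Ξ σ) x) ∧
    ∀ U ⊆ Φ.carrier, IsOpen U → ∀ σ : X → Y,
      ContMDiffOn (IX (n + 1)) (IY (n + 1) m) ∞ σ U → (∀ x ∈ U, π (σ x) = x ∧ σ x ∈ D) →
      (∀ x ∈ U, eulerLagrange hY.fibered L σ (Ξ.lieSec σ x) x = 0) →
      ∀ x ∈ U, extD (currentAlong L p Ξ σ) x = 0 := by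
  -- The carrier is the slice at time zero of the open flow domain.
  have hcarrier : IsOpen Φ.carrier := Φ.isOpen_dom.preimage (Continuous.prodMk_right (0 : ℝ))
  have hsym := hL Φ hΦ Ξ hΞ
  refine ⟨fun x hx σ h hσD =>
    hsym.zero_eq_add_extD_currentAlong hY.fibered hD hcarrier hp hx h hσD, ?_⟩
  intro U hU hUo σ hσ hsec hcrit x hx
  -- Since `U` is open, a section over `U` is a section near each of its points, so the pointwise
  -- identity of the first part applies.
  have h : IsSectionAt (IX (n + 1)) (IY (n + 1) m) π x σ := by
    refine ⟨?_, ?_⟩ <;> filter_upwards [hUo.mem_nhds hx] with x' hx'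
    · exact hσ.contMDiffAt (hUo.mem_nhds hx')
    · exact (hsec x' hx').1
  have := hsym.zero_eq_add_extD_currentAlong hY.fibered hD hcarrier hp (hU hx) h (hsec x hx).2
  rw [hcrit x hx, neg_zero, zero_add] at this
  exact this.symm
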